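/- Let $k$ be a field. An arrangement $\mathcal{A}=(\mathcal{I},V,a)$ over $k$ consists of a finite set $\mathcal{I}$, a finite dimensional $k$-vector space $V$ and a map $a:\mathcal{I}\to V^*\smallsetminus\{0\}$ whose image spans $V^*$. Let $U_{\mathcal{A}}\subset V$ be the open subscheme where all $a(i)$ are nonzero, and let the reciprocal plane $X_{\mathcal{A}}$ be the (reduced) Zariski closure in the affine space $k^{\mathcal{I}}$ of the image of $U_{\mathcal{A}}$ under $v\mapsto (a(i)(v)^{-1})_{i\in\mathcal{I}}$; equivalently $X_{\mathcal A}$ is the spectrum of the subalgebra of $k(V)$ generated by the $a(i)^{-1}$. Write $u_i$ for the coordinates on $k^{\mathcal I}$. A set $S\subset\mathcal I$ is independent in the matroid $M_{\mathcal A}$ if $a$ is injective on $S$ with linearly independent image. For a flat $F$ of $M_{\mathcal A}$ let $V^F=\{v\in V\mid a(i)(v)=0 \text{ for all } i\in F\}$ and let the restriction $\mathcal{A}^F$ be the arrangement $(\mathcal{I}\smallsetminus F, V^F, a^F)$ with $a^F(j)=a(j)|_{V^F}$. Let $W_{\mathcal A,F}\subset X_{\mathcal A}$ be the open subscheme where $u_i\neq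 0$ for all $i\in F$, and let $X_{\mathcal A,F}\subset X_{\mathcal A}$ be the stratum of points at which $u_i$ vanishes if and only if $i\notin F$, a locally closed subscheme with its reduced structure. **Theorem.** Let $F$ be a flat of $\mathcal A$ and let $x$ be a point of the scheme $X_{\mathcal A,F}$. Then there are an open subscheme $\mathring{W}_{\mathcal A,F}\subset W_{\mathcal A,F}$ containing $x$ and a morphism of $k$-schemes $$\Phi:\mathring{W}_{\mathcal A,F}\to X_{\mathcal A^F}\times_k X_{\mathcal A,F}$$ such that $\Phi(x)=(0,x)$ (as points with values in the residue field of $x$, where $0$ is the origin of $k^{\mathcal I\smallsetminus F}$, which lies in $X_{\mathcal A^F}$) and $\Phi$ is étale at $x$. -/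

import Mathlib

open CategoryTheory CategoryTheory.Limits AlgebraicGeometry

universe u v

/-- An arrangement over `k` with (finite) index set `I` in the finite dimensional space `V`:
a family of nonzero linear functionals that spans the dual space. -/
structure Arrangement (k : Type u) (I : Type u) (V : Type v) [Field k] [Finite I]
    [AddCommGroup V] [Module k V] [FiniteDimensional k V] where
  /-- the functionals -/
  a : I → Module.Dual k V
  ne_zero : ∀ i, a i ≠ 0
  span_eq_top : Submodule.span k (Set.range a) = ⊤

namespace Arrangement

noncomputable section

variable {k : Type u} {I : Type u} {V : Type v} [Field k] [Finite I]
  [AddCommGroup V] [Module k V] [FiniteDimensional k V]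

/-! ### The matroid and the restriction to a flat -/

theorem indep_augment (A : Arrangement k I V) {S T : Set I} (hS : LinearIndepOn k A.a S)
    (hT : LinearIndepOn k A.a T) (h : S.ncard < T.ncard) :
    ∃ e ∈ T, e ∉ S ∧ LinearIndepOn k A.a (insert e S) := by
  classical
  by_contra! hcon
  have hsub : A.a '' T ⊆ Submodule.span k (A.a '' S) := by
    rintro _ ⟨e, he, rfl⟩
    by_contra hn
    have h1 := hS.notMem_span_iff.1 hn
    exact hcon e he h1.2 h1.1
  have hle := Submodule.span_le.2 hsub
  have hfin := Submodule.finrank_mono hle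
  have e1 : Module.finrank k (Submodule.span k (A.a '' S)) = S.ncard := by
    have := Fintype.ofFinite S
    rw [Set.image_eq_range, finrank_span_eq_card hS, ← Nat.card_eq_fintype_card,
      Nat.card_coe_set_eq]
  have e2 : Module.finrank k (Submodule.span k (A.a '' T)) = T.ncard := by
    have := Fintype.ofFinite T
    rw [Set.image_eq_range, finrank_span_eq_card hT, ← Nat.card_eq_fintype_card,
      Nat.card_coe_set_eq]
  omega

/-- The matroid represented by the arrangement: a set of indices is independent if the functionals
indexed by it are pairwise distinct and linearly independent. -/
def matroid (A : Arrangement k I V) : Matroid I :=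
  (IndepMatroid.ofFinite (E := Set.univ) Set.finite_univ (fun S => LinearIndepOn k A.a S)
    (linearIndepOn_empty k A.a) (fun _ _ hJ h => hJ.mono h)
    (fun _ _ hS hT h => A.indep_augment hS hT h) (fun _ _ => Set.subset_univ _)).matroid

theorem matroid_indep_iff (A : Arrangement k I V) (S : Set I) :
    A.matroid.Indep S ↔ LinearIndepOn k A.a S := by
  simp [matroid]

theorem matroid_E (A : Arrangement k I V) : A.matroid.E = Set.univ := rfl

/-- A functional whose index lies outside of a flat is not in the span of the flat. -/
theorem notMem_span_of_isFlat (A : Arrangement k I V) {F : Set I} (hF : A.matroid.IsFlat F)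
    {j : I} (hj : j ∉ F) : A.a j ∉ Submodule.span k (A.a '' F) := by
  intro hmem
  obtain ⟨B, hB⟩ := A.matroid.exists_isBasis F (Set.subset_univ _)
  have hBi := (A.matroid_indep_iff B).1 hB.indep
  have hspan : A.a '' F ⊆ Submodule.span k (A.a '' B) := by
    rintro _ ⟨e, he, rfl⟩
    by_contra hn
    have h1 := hBi.notMem_span_iff.1 hn
    exact h1.2 (hB.mem_of_insert_indep he ((A.matroid_indep_iff _).2 h1.1))
  have hj' : A.a j ∈ Submodule.span k (A.a '' B) := Submodule.span_le.2 hspan hmem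
  have hj2 : j ∈ A.matroid.closure B := by
    rw [hB.indep.mem_closure_iff' ]
    refine ⟨Set.mem_univ _, fun h => ?_⟩
    exact hBi.mem_span_iff.1 hj' ((A.matroid_indep_iff _).1 h)
  have hbas : A.matroid.IsBasis B (insert j F) := by
    refine hB.indep.isBasis_of_subset_of_subset_closure
      (hB.subset.trans (Set.subset_insert _ _)) ?_
    exact Set.insert_subset hj2 hB.subset_closure
  exact hj (hF.subset_of_isBasis_of_isBasis hB hbas (Set.mem_insert _ _))

/-- The subspace `V^F` of `V` on which all functionals indexed by `F` vanish. -/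
def flatSpace (A : Arrangement k I V) (F : Set I) : Submodule k V :=
  (Submodule.span k (A.a '' F)).dualCoannihilator

/-- The restriction `A^F` of an arrangement at a flat `F`: the functionals indexed by the complement
of `F`, restricted to `V^F`. -/
def restriction (A : Arrangement k I V) (F : Set I) (hF : A.matroid.IsFlat F) :
    Arrangement k (Fᶜ : Set I) (A.flatSpace F) where
  a j := (A.a j).domRestrict (A.flatSpace F)
  ne_zero j h := by
    refine A.notMem_span_of_isFlat hF j.2 ?_
    rw [← Subspace.dualCoannihilator_dualAnnihilator_eq (W := Submodule.span k (A.a '' F)),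
      Submodule.mem_dualAnnihilator]
    intro w hw
    exact LinearMap.congr_fun h ⟨w, hw⟩
  span_eq_top := by
    have hsurj := Subspace.dualRestrict_surjective (W := A.flatSpace F)
    rw [eq_top_iff, ← LinearMap.range_eq_top.2 hsurj, LinearMap.range_eq_map, ← A.span_eq_top,
      Submodule.map_span, Submodule.span_le]
    rintro _ ⟨_, ⟨i, rfl⟩, rfl⟩
    by_cases hi : i ∈ F
    · have h0 : (A.flatSpace F).dualRestrict (A.a i) = 0 := by
        ext w
        exact (Submodule.mem_dualCoannihilator _).1 w.2 _
          (Submodule.subset_span (Set.mem_image_of_mem _ hi))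
      rw [h0]
      exact Submodule.zero_mem _
    · exact Submodule.subset_span ⟨⟨i, hi⟩, rfl⟩

/-! ### The reciprocal plane -/

/-- The multiplicative set generated by the functionals, in the ring `Sym V^*` of regular functions
on `V`. -/
def denominators (A : Arrangement k I V) :
    Submonoid (SymmetricAlgebra k (Module.Dual k V)) :=
  Submonoid.closure (Set.range fun i => SymmetricAlgebra.ι k (Module.Dual k V) (A.a i))

/-- The ring of regular functions on the complement `U_A`: the ring `Sym V^*` of regular functions
on `V` with all the functionals of the arrangement inverted. -/
abbrev complementRing (A : Arrangement k I V) : Type (max u v) :=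
  Localization A.denominators

/-- The functional `a i` as an invertible function on the complement. -/
def functionalUnit (A : Arrangement k I V) (i : I) : A.complementRingˣ :=
  (IsLocalization.map_units A.complementRing
    (⟨SymmetricAlgebra.ι k (Module.Dual k V) (A.a i),
      Submonoid.subset_closure ⟨i, rfl⟩⟩ : A.denominators)).unit

/-- The pullback of polynomial functions on `k^I` along the map `U_A → k^I` with coordinates
`(a i)⁻¹`, the image of which is `U_A⁻¹`. -/
def reciprocalHom (A : Arrangement k I V) : MvPolynomial I k →ₐ[k] A.complementRing :=
  MvPolynomial.aeval fun i => ((A.functionalUnit i)⁻¹ : A.complementRingˣ).val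

/-- The ideal of the polynomial functions on `k^I` that vanish on `U_A⁻¹`. -/
def vanishingIdeal (A : Arrangement k I V) : Ideal (MvPolynomial I k) :=
  RingHom.ker A.reciprocalHom

/-- The vanishing ideal cuts out the closure of the image of `U_A → k^I`, `v ↦ ((a i v)⁻¹)`. -/
theorem zeroLocus_vanishingIdeal (A : Arrangement k I V) :
    PrimeSpectrum.zeroLocus (A.vanishingIdeal : Set (MvPolynomial I k)) =
      closure (Set.range (PrimeSpectrum.comap A.reciprocalHom.toRingHom)) :=
  (PrimeSpectrum.closure_range_comap _).symm

/-- The coordinate ring of the closure of `U_A⁻¹` in `k^I` (the Orlik-Terao algebra). -/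
def coordRing (A : Arrangement k I V) : Type u :=
  MvPolynomial I k ⧸ A.vanishingIdeal

instance (A : Arrangement k I V) : CommRing A.coordRing :=
  Ideal.Quotient.commRing A.vanishingIdeal

instance (A : Arrangement k I V) : Algebra k A.coordRing :=
  Ideal.Quotient.algebra k

/-- The restriction of polynomial functions from `k^I` to the reciprocal plane. -/
def toCoordRing (A : Arrangement k I V) : MvPolynomial I k →ₐ[k] A.coordRing :=
  Ideal.Quotient.mkₐ k A.vanishingIdeal

/-- The `i`-th coordinate function on the reciprocal plane. -/
def coord (A : Arrangement k I V) (i : I) : A.coordRing :=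
  A.toCoordRing (MvPolynomial.X i)

/-- The reciprocal plane `X_A`: the Zariski closure of `U_A⁻¹` in the affine space `k^I`. -/
abbrev recipPlane (A : Arrangement k I V) : Scheme.{u} :=
  Spec (.of A.coordRing)

/-- The structure morphism of the reciprocal plane. -/
def recipPlaneToBase (A : Arrangement k I V) : A.recipPlane ⟶ Spec (.of k) :=
  Spec.map (CommRingCat.ofHom (algebraMap k A.coordRing))

/-! ### The origin of the reciprocal plane -/

theorem ι_ne_zero {k : Type u} {V : Type v} [Field k] [AddCommGroup V] [Module k V] {m : Module.Dual k V} (hm : m ≠ 0) :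
    SymmetricAlgebra.ι k (Module.Dual k V) m ≠ 0 := by
  intro h
  obtain ⟨w, hw⟩ : ∃ w, m w ≠ 0 := by
    by_contra! hcon
    exact hm (LinearMap.ext hcon)
  have h2 := congrArg (SymmetricAlgebra.lift (Module.Dual.eval k V w)) h
  rw [SymmetricAlgebra.lift_ι_apply, map_zero] at h2
  exact hw h2

instance (A : Arrangement k I V) : Nontrivial A.complementRing := by
  refine (IsLocalization.injective A.complementRing (M := A.denominators) ?_).nontrivial
  refine Submonoid.closure_le.2 ?_
  rintro _ ⟨i, rfl⟩
  exact mem_nonZeroDivisors_of_ne_zero (ι_ne_zero (A.ne_zero i))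

/-- Polynomials that vanish on `U_A⁻¹` have no constant term, so that the origin lies in the
reciprocal plane. -/
theorem constantCoeff_of_mem (A : Arrangement k I V) {f : MvPolynomial I k}
    (hf : f ∈ A.vanishingIdeal) : MvPolynomial.constantCoeff f = 0 := by
  let R := A.complementRing
  let L := LaurentPolynomial R
  let ψ₀ : SymmetricAlgebra k (Module.Dual k V) →ₐ[k] L :=
    SymmetricAlgebra.lift (A := L)
      ((LinearMap.mulRight k (LaurentPolynomial.T (-1) : L)).comp
        ((IsScalarTower.toAlgHom k R L).toLinearMap.comp
          ((IsScalarTower.toAlgHom k (SymmetricAlgebra k (Module.Dual k V)) R).toLinearMap.comp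
            (SymmetricAlgebra.ι k (Module.Dual k V)))))
  have hψ₀ (m) : ψ₀ (SymmetricAlgebra.ι k (Module.Dual k V) m) =
      algebraMap R L (algebraMap _ R (SymmetricAlgebra.ι k (Module.Dual k V) m)) *
        LaurentPolynomial.T (-1) := by
    simp only [ψ₀, SymmetricAlgebra.lift_ι_apply]
    rfl
  have hunit : ∀ y : A.denominators, IsUnit (ψ₀.toRingHom y) := by
    rintro ⟨y, hy⟩
    induction hy using Submonoid.closure_induction with
    | mem x hx =>
      obtain ⟨i, rfl⟩ := hx
      change IsUnit (ψ₀ _)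
      rw [hψ₀]
      exact ((A.functionalUnit i).isUnit.map (algebraMap R L)).mul
        (LaurentPolynomial.isUnit_T (-1))
    | one => simp
    | mul x y _ _ hx hy =>
      have : ψ₀.toRingHom (x * y) = ψ₀.toRingHom x * ψ₀.toRingHom y := map_mul _ _ _
      change IsUnit (ψ₀.toRingHom (x * y))
      rw [this]
      exact hx.mul hy
  let ψ : R →+* L := IsLocalization.lift hunit
  have hψ (i : I) : ψ ((A.functionalUnit i)⁻¹ : Rˣ).val =
      Polynomial.toLaurent (Polynomial.C ((A.functionalUnit i)⁻¹ : Rˣ).val * Polynomial.X) := by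
    have h1 : ψ (A.functionalUnit i).val =
        algebraMap R L (A.functionalUnit i).val * LaurentPolynomial.T (-1) := by
      exact (IsLocalization.lift_eq hunit _).trans (hψ₀ _)
    have h2 : ψ ((A.functionalUnit i)⁻¹ : Rˣ).val * ψ (A.functionalUnit i).val = 1 := by
      rw [← map_mul, Units.inv_mul, map_one]
    have h3 : Polynomial.toLaurent
        (Polynomial.C ((A.functionalUnit i)⁻¹ : Rˣ).val * Polynomial.X) *
          ψ (A.functionalUnit i).val = 1 := by
      rw [h1, map_mul, Polynomial.toLaurent_C, Polynomial.toLaurent_X]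
      have : algebraMap R L (A.functionalUnit i).val =
        LaurentPolynomial.C (A.functionalUnit i).val := rfl
      rw [this]
      refine (mul_mul_mul_comm (G := L) _ _ _ _).trans ?_
      rw [← map_mul, Units.inv_mul, map_one, ← LaurentPolynomial.T_add]
      simp
    have hu : IsUnit (ψ (A.functionalUnit i).val) := (A.functionalUnit i).isUnit.map ψ
    exact hu.mul_right_cancel (h2.trans h3.symm)
  let g : MvPolynomial I k →+* Polynomial R :=
    MvPolynomial.eval₂Hom (algebraMap k (Polynomial R))
      fun i => Polynomial.C ((A.functionalUnit i)⁻¹ : Rˣ).val * Polynomial.X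
  have hcomp : ψ.comp A.reciprocalHom.toRingHom = Polynomial.toLaurent.comp g := by
    apply MvPolynomial.ringHom_ext
    · intro r
      have e1 : A.reciprocalHom.toRingHom (MvPolynomial.C r) = algebraMap _ R
          (algebraMap k (SymmetricAlgebra k (Module.Dual k V)) r) := by
        change MvPolynomial.aeval _ _ = _
        rw [MvPolynomial.aeval_C]
        exact IsScalarTower.algebraMap_apply _ _ _ _
      have e2 : ψ (algebraMap _ R (algebraMap k (SymmetricAlgebra k (Module.Dual k V)) r)) =
          ψ₀ (algebraMap k (SymmetricAlgebra k (Module.Dual k V)) r) :=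
        IsLocalization.lift_eq _ _
      rw [RingHom.comp_apply, RingHom.comp_apply, e1, e2, AlgHom.commutes]
      simp only [g, MvPolynomial.coe_eval₂Hom, MvPolynomial.eval₂_C]
      rw [IsScalarTower.algebraMap_apply k R (Polynomial R), Polynomial.algebraMap_eq,
        Polynomial.toLaurent_C, IsScalarTower.algebraMap_apply k R L]
      rfl
    · intro i
      have e1 : A.reciprocalHom.toRingHom (MvPolynomial.X i) =
          ((A.functionalUnit i)⁻¹ : Rˣ).val := by
        change MvPolynomial.aeval _ _ = _
        rw [MvPolynomial.aeval_X]
      rw [RingHom.comp_apply, RingHom.comp_apply, e1, hψ]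
      simp [g]
  have hg0 : g f = 0 := by
    apply Polynomial.toLaurent_injective
    have := RingHom.congr_fun hcomp f
    rw [RingHom.comp_apply, RingHom.comp_apply] at this
    rw [← this, map_zero]
    have h0 : A.reciprocalHom.toRingHom f = 0 := hf
    rw [h0, map_zero]
  have hconst : (Polynomial.constantCoeff (R := R)).comp g =
      (algebraMap k R).comp MvPolynomial.constantCoeff := by
    apply MvPolynomial.ringHom_ext
    · intro r
      simp only [g, RingHom.comp_apply, MvPolynomial.coe_eval₂Hom, MvPolynomial.eval₂_C,
        MvPolynomial.constantCoeff_C]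
      rw [IsScalarTower.algebraMap_apply k R (Polynomial R), Polynomial.algebraMap_eq]
      simp
    · intro i
      simp [g]
  have := RingHom.congr_fun hconst f
  rw [RingHom.comp_apply, RingHom.comp_apply, hg0, map_zero] at this
  exact (map_eq_zero (algebraMap k R)).1 this.symm

/-- Evaluation at the origin of `k^I` of functions on the reciprocal plane. -/
def evalZero (A : Arrangement k I V) : A.coordRing →+* k :=
  Ideal.Quotient.lift A.vanishingIdeal MvPolynomial.constantCoeff
    fun _ hf => A.constantCoeff_of_mem hf

/-- The origin `0` of `k^I`, as a `k`-rational point of the reciprocal plane: all coordinate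
functions are evaluated at zero. -/
def origin (A : Arrangement k I V) : Spec (.of k) ⟶ A.recipPlane :=
  Spec.map (CommRingCat.ofHom A.evalZero)

/-! ### Strata -/

/-- The open subscheme `W_{A,F}` of the reciprocal plane defined by the nonvanishing of the
coordinates indexed by `F`. -/
def openStar (A : Arrangement k I V) (F : Set I) : A.recipPlane.Opens where
  carrier := {y : PrimeSpectrum A.coordRing | ∀ i : F, A.coord i ∉ y.asIdeal}
  is_open' := by
    have : {y : PrimeSpectrum A.coordRing | ∀ i : F, A.coord i ∉ y.asIdeal} =
        ⋂ i : F, (PrimeSpectrum.basicOpen (A.coord i) : Set (PrimeSpectrum A.coordRing)) := by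
      ext y
      simp
    exact this ▸ isOpen_iInter_of_finite fun i : F => (PrimeSpectrum.basicOpen (A.coord i)).isOpen

/-- The ideal of the functions on `X_A` that vanish on the closed locus where all the coordinates
that are not indexed by `F` vanish. -/
def stratumIdeal (A : Arrangement k I V) (F : Set I) : Ideal A.coordRing :=
  (Ideal.span (A.coord '' Fᶜ)).radical

/-- The coordinate ring of the reduced closed subscheme of `X_A` on which the coordinates that are
not indexed by `F` vanish. -/
def closedStratumRing (A : Arrangement k I V) (F : Set I) : Type u :=
  A.coordRing ⧸ A.stratumIdeal F

instance (A : Arrangement k I V) (F : Set I) : CommRing (A.closedStratumRing F) :=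
  Ideal.Quotient.commRing (A.stratumIdeal F)

/-- The restriction of functions from `X_A` to that closed subscheme. -/
def toClosedStratumRing (A : Arrangement k I V) (F : Set I) :
    A.coordRing →+* A.closedStratumRing F :=
  Ideal.Quotient.mk (A.stratumIdeal F)

/-- The coordinate ring of the stratum `X_{A,F}`: the coordinates indexed by `F` are inverted in the
coordinate ring of the reduced locus where the other coordinates vanish. -/
abbrev stratumRing (A : Arrangement k I V) (F : Set I) : Type u :=
  Localization (Submonoid.closure
    (Set.range fun i : F => A.toClosedStratumRing F (A.coord i)))

/-- The stratum `X_{A,F}`, with its reduced structure: the locus in the reciprocal plane where the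
`i`-th coordinate vanishes if and only if `i ∉ F`. -/
abbrev stratum (A : Arrangement k I V) (F : Set I) : Scheme.{u} :=
  Spec (.of (A.stratumRing F))

/-- The inclusion of the stratum `X_{A,F}` into the reciprocal plane. -/
def stratumι (A : Arrangement k I V) (F : Set I) : A.stratum F ⟶ A.recipPlane :=
  Spec.map (CommRingCat.ofHom
    ((algebraMap (A.closedStratumRing F) (A.stratumRing F)).comp (A.toClosedStratumRing F)))

/-- The structure morphism of the stratum. -/
def stratumToBase (A : Arrangement k I V) (F : Set I) : A.stratum F ⟶ Spec (.of k) :=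
  A.stratumι F ≫ A.recipPlaneToBase

/-- The points of the stratum are the points of the reciprocal plane whose `i`-th coordinate
vanishes if and only if `i ∉ F`. -/
theorem range_stratumι (A : Arrangement k I V) (F : Set I) :
    Set.range (A.stratumι F) =
      {y : PrimeSpectrum A.coordRing | ∀ i, A.coord i ∈ y.asIdeal ↔ i ∉ F} := by
  set M := Submonoid.closure
    (Set.range fun i : F => A.toClosedStratumRing F (A.coord i)) with hM
  have h1 : Set.range (A.stratumι F) =
      PrimeSpectrum.comap (A.toClosedStratumRing F) ''
        {p : PrimeSpectrum (A.closedStratumRing F) |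
          Disjoint (M : Set (A.closedStratumRing F)) p.asIdeal} := by
    rw [← PrimeSpectrum.localization_comap_range (A.stratumRing F) M, ← Set.range_comp]
    rfl
  rw [h1]
  have hdisj (p : PrimeSpectrum (A.closedStratumRing F)) :
      Disjoint (M : Set (A.closedStratumRing F)) p.asIdeal ↔
        ∀ i ∈ F, A.toClosedStratumRing F (A.coord i) ∉ p.asIdeal := by
    constructor
    · intro h i hi hmem
      exact Set.disjoint_left.1 h (Submonoid.subset_closure ⟨⟨i, hi⟩, rfl⟩) hmem
    · intro h
      have : M ≤ p.asIdeal.primeCompl := by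
        refine Submonoid.closure_le.2 ?_
        rintro _ ⟨i, rfl⟩
        exact h i i.2
      exact Set.disjoint_left.2 fun z hz => this hz
  ext y
  constructor
  · rintro ⟨p, hp, rfl⟩ i
    constructor
    · exact fun h hi => (hdisj p).1 hp i hi h
    · intro hi
      change A.toClosedStratumRing F (A.coord i) ∈ p.asIdeal
      have : A.coord i ∈ A.stratumIdeal F :=
        Ideal.le_radical (Ideal.subset_span (Set.mem_image_of_mem _ hi))
      rw [show A.toClosedStratumRing F (A.coord i) = 0 from Ideal.Quotient.eq_zero_iff_mem.2 this]
      exact zero_mem _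
  · intro hy
    have hle : A.stratumIdeal F ≤ PrimeSpectrum.asIdeal y := by
      refine Ideal.IsPrime.radical_le_iff (PrimeSpectrum.isPrime y) |>.2 (Ideal.span_le.2 ?_)
      rintro _ ⟨i, hi, rfl⟩
      exact (hy i).2 hi
    have hr : y ∈ Set.range (PrimeSpectrum.comap (A.toClosedStratumRing F)) := by
      rw [range_comap_of_surjective _ (A.toClosedStratumRing F)
        Ideal.Quotient.mk_surjective, show RingHom.ker (A.toClosedStratumRing F) = A.stratumIdeal F
          from Ideal.mk_ker]
      exact hle
    obtain ⟨p, rfl⟩ := hr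
    exact ⟨p, (hdisj p).2 fun i hi h => (hy i).1 h hi, rfl⟩

/-- The product `X_{A^F} × X_{A,F}` over `k`. -/
abbrev sliceProduct (A : Arrangement k I V) (F : Set I) (hF : A.matroid.IsFlat F) : Scheme.{u} :=
  pullback (A.restriction F hF).recipPlaneToBase (A.stratumToBase F)

/-- The structure morphism of the product `X_{A^F} × X_{A,F}`. -/
def sliceProductToBase (A : Arrangement k I V) (F : Set I) (hF : A.matroid.IsFlat F) :
    A.sliceProduct F hF ⟶ Spec (.of k) :=
  pullback.snd (A.restriction F hF).recipPlaneToBase (A.stratumToBase F) ≫ A.stratumToBase F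

theorem origin_toBase (A : Arrangement k I V) :
    A.origin ≫ A.recipPlaneToBase = 𝟙 _ := by
  rw [origin, recipPlaneToBase, ← Spec.map_comp, ← CommRingCat.ofHom_comp]
  have : A.evalZero.comp (algebraMap k A.coordRing) = RingHom.id k := by
    ext r
    exact MvPolynomial.constantCoeff_C (σ := I) r
  rw [this]
  exact Spec.map_id _

/-- The morphism `X_{A,F} → X_{A^F} × X_{A,F}`, `x ↦ (0, x)`. -/
def zeroSection (A : Arrangement k I V) (F : Set I) (hF : A.matroid.IsFlat F) :
    A.stratum F ⟶ A.sliceProduct F hF :=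
  pullback.lift (A.stratumToBase F ≫ (A.restriction F hF).origin) (𝟙 _)
    (by rw [Category.assoc, origin_toBase, Category.comp_id, Category.id_comp])

end

end Arrangement

/-- A morphism of schemes is étale at a point if it is étale on an open neighbourhood of it. -/
def EtaleAt {X Y : Scheme.{u}} (f : X ⟶ Y) (x : X) : Prop :=
  ∃ U : X.Opens, x ∈ U ∧ Etale (U.ι ≫ f)

/-!
On the open star of `F`, the functionals in the span of `F` are regular functions, since
`u_i = (a i)⁻¹` is invertible for `i ∈ F`. Choosing a complement of this span, each `a j` with
`j ∉ F` is the sum of a functional on `V^F` and a component `c_j` in the span. In terms of the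
reciprocals `w_j` of the former and `u_j` of `a j`, this reads `1 / u_j = 1 / w_j + c_j`, that is,
`u_j = w_j / (1 + c_j w_j)` and `w_j = u_j / (1 - c_j u_j)`. Hence the open subscheme of `X_A` where
the `u_i` with `i ∈ F` and all `1 - c_j u_j` are invertible is isomorphic to the open subscheme of
`X_{A^F} × X_{A,F}` where all `1 + c_j w_j` are invertible. It contains the whole stratum, where
`u_j = 0` for `j ∉ F`, and there the isomorphism is `x ↦ (0, x)`.

That the two formulas define maps between the reciprocal planes is checked on the complements of the
arrangements, where it amounts to giving points of `V` and of `V^F`. To project to the stratum,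
substitute `w = 0`: this replaces the `u_j` with `j ∉ F` by zero.
-/

section

open scoped TensorProduct

theorem hasFiniteMulSupport_of_finite {ι M : Type*} [One M] [Finite ι] (f : ι → M) :
    Function.HasFiniteMulSupport f :=
  Set.toFinite _

theorem isUnit_map_finprod_iff {ι M N G : Type*} [CommMonoid M] [CommMonoid N] [FunLike G M N]
    [MonoidHomClass G M N] [Finite ι] (g : G) (f : ι → M) :
    IsUnit (g (∏ᶠ i, f i)) ↔ ∀ i, IsUnit (g (f i)) := by
  have := Fintype.ofFinite ι
  rw [map_finprod g (hasFiniteMulSupport_of_finite f), finprod_eq_prod_of_fintype,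
    IsUnit.prod_univ_iff]

theorem tmul_one_mul_one_tmul {k S T : Type*} [CommRing k] [CommRing S] [CommRing T] [Algebra k S]
    [Algebra k T] (s : S) (t : T) : (s ⊗ₜ[k] (1 : T)) * ((1 : S) ⊗ₜ[k] t) = s ⊗ₜ[k] t := by
  rw [Algebra.TensorProduct.tmul_mul_tmul, mul_one, one_mul]

section AwayMap

variable {k B Q : Type*} [CommRing k] [CommRing B] [CommRing Q] [Algebra k B] [Algebra k Q]

theorem awayMapₐ_algebraMap (t : B →ₐ[k] Q) (b x : B) :
    IsLocalization.Away.mapₐ (Localization.Away b) (Localization.Away (t b)) t b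
      (algebraMap B _ x) = algebraMap Q _ (t x) := by
  rw [IsLocalization.Away.mapₐ_apply]
  exact IsLocalization.map_eq _ x

theorem awayLiftAlgHom_algebraMap (f : B →ₐ[k] Q) {b : B} (hb : IsUnit (f b)) (x : B) :
    IsLocalization.Away.liftAlgHom (S := Localization.Away b) b hb (algebraMap B _ x) = f x :=
  IsLocalization.Away.lift_eq (g := f.toRingHom) b hb x

theorem exists_mul_awayMapₐ_eq_one {t : B →ₐ[k] Q} {b : B} {x : Q}
    (h : ∃ n d, d ∣ b ∧ x * t n = t d) :
    ∃ c : Localization.Away b, algebraMap Q (Localization.Away (t b)) x *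
      IsLocalization.Away.mapₐ (Localization.Away b) (Localization.Away (t b)) t b c = 1 := by
  obtain ⟨n, d, hdb, hnd⟩ := h
  obtain ⟨c, hc⟩ := (isUnit_of_dvd_unit (map_dvd (algebraMap B (Localization.Away b)) hdb)
    (IsLocalization.Away.algebraMap_isUnit b)).exists_right_inv
  refine ⟨algebraMap _ _ n * c, ?_⟩
  rw [map_mul, awayMapₐ_algebraMap, ← mul_assoc, ← map_mul, hnd, ← awayMapₐ_algebraMap,
    ← map_mul, hc, map_one]

end AwayMap

/-- The morphism of affine schemes given by a homomorphism of algebras. -/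
noncomputable def specMapAlgHom {k S T : Type u} [CommRing k] [CommRing S] [CommRing T]
    [Algebra k S] [Algebra k T] (f : S →ₐ[k] T) : Spec (.of T) ⟶ Spec (.of S) :=
  Spec.map (CommRingCat.ofHom f.toRingHom)

section SpecMapAlgHom

variable {k S T B : Type u} [CommRing k] [CommRing S] [CommRing T] [CommRing B]
  [Algebra k S] [Algebra k T] [Algebra k B]

theorem specMapAlgHom_comp (f : S →ₐ[k] T) (g : T →ₐ[k] B) :
    specMapAlgHom g ≫ specMapAlgHom f = specMapAlgHom (g.comp f) := by
  rw [specMapAlgHom, specMapAlgHom, ← Spec.map_comp, ← CommRingCat.ofHom_comp]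
  rfl

theorem specMapAlgHom_id : specMapAlgHom (AlgHom.id k S) = 𝟙 _ :=
  Spec.map_id _

theorem specMapAlgHom_comp_algebraMap (f : S →ₐ[k] T) :
    specMapAlgHom f ≫ Spec.map (CommRingCat.ofHom (algebraMap k S)) =
      Spec.map (CommRingCat.ofHom (algebraMap k T)) := by
  rw [specMapAlgHom, ← Spec.map_comp, ← CommRingCat.ofHom_comp]
  exact congrArg (fun r => Spec.map (CommRingCat.ofHom r)) f.comp_algebraMap

theorem isOpenImmersion_specMapAlgHom_of_algEquiv (f : S →ₐ[k] T) (h : S)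
    (e : Localization.Away h ≃ₐ[k] T) (he : ∀ x, e (algebraMap S _ x) = f x) :
    IsOpenImmersion (specMapAlgHom f) := by
  have hf : specMapAlgHom f = Spec.map e.toRingEquiv.toCommRingCatIso.hom ≫
      Spec.map (CommRingCat.ofHom (algebraMap S (Localization.Away h))) := by
    rw [← Spec.map_comp, specMapAlgHom]
    congr 1
    ext x
    exact (he x).symm
  have : IsOpenImmersion (Spec.map (CommRingCat.ofHom (algebraMap S (Localization.Away h)))) :=
    IsOpenImmersion.of_isLocalization h
  rw [hf]
  infer_instance

end SpecMapAlgHom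

end

namespace Arrangement

noncomputable section

open scoped TensorProduct

variable {k : Type u} {I : Type u} {V : Type v} [Field k] [Finite I]
  [AddCommGroup V] [Module k V] [FiniteDimensional k V] (A : Arrangement k I V)

/-! ### Points of the complement and of the reciprocal plane -/

section Complement

/-- The ring of functions on the complement, as an algebra over `k`. The additive structure of the
type `complementRing` is found by instance search independently of its multiplication, which gets
in the way of forming tensor products; that of this copy comes from the ring structure. -/
def complementAlgebra : Type (max u v) :=
  A.complementRing

instance : CommRing A.complementAlgebra :=
  inferInstanceAs (CommRing A.complementRing)

instance : Algebra k A.complementAlgebra :=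
  inferInstanceAs (Algebra k A.complementRing)

instance : Algebra (SymmetricAlgebra k (Module.Dual k V)) A.complementAlgebra :=
  inferInstanceAs (Algebra (SymmetricAlgebra k (Module.Dual k V)) A.complementRing)

instance : IsScalarTower k (SymmetricAlgebra k (Module.Dual k V)) A.complementAlgebra :=
  inferInstanceAs (IsScalarTower k (SymmetricAlgebra k (Module.Dual k V)) A.complementRing)

instance : IsLocalization A.denominators A.complementAlgebra :=
  inferInstanceAs (IsLocalization A.denominators A.complementRing)

/-- The linear functions on `V`, as functions on the complement. -/
def linearFunction : Module.Dual k V →ₗ[k] A.complementAlgebra :=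
  (IsScalarTower.toAlgHom k (SymmetricAlgebra k (Module.Dual k V))
    A.complementAlgebra).toLinearMap ∘ₗ
    SymmetricAlgebra.ι k (Module.Dual k V)

/-- The restriction of functions from the reciprocal plane to the complement, along
`v ↦ (a i v)⁻¹`. -/
def toComplementRing : A.coordRing →ₐ[k] A.complementAlgebra :=
  Ideal.Quotient.liftₐ A.vanishingIdeal A.reciprocalHom fun _ h => h

theorem linearFunction_mul_coord (i : I) :
    A.linearFunction (A.a i) * A.toComplementRing (A.coord i) = 1 := by
  have hcoord : A.toComplementRing (A.coord i) =
      ((A.functionalUnit i)⁻¹ : A.complementRingˣ).val :=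
    MvPolynomial.aeval_X _ _
  rw [hcoord]
  exact (A.functionalUnit i).mul_inv

theorem toComplementRing_injective : Function.Injective A.toComplementRing := by
  rw [injective_iff_map_eq_zero]
  intro f hf
  obtain ⟨f, rfl⟩ := Ideal.Quotient.mk_surjective f
  exact Ideal.Quotient.eq_zero_iff_mem.2 hf

instance : _root_.IsReduced A.coordRing :=
  have : _root_.IsReduced A.complementAlgebra :=
    isReduced_localizationPreserves A.denominators _ inferInstance
  isReduced_of_injective A.toComplementRing A.toComplementRing_injective

variable {A} in
theorem coordRing_algHom_ext {B : Type*} [CommRing B] [Algebra k B]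
    {f g : A.coordRing →ₐ[k] B} (h : ∀ i, f (A.coord i) = g (A.coord i)) : f = g :=
  Ideal.Quotient.algHom_ext _ (MvPolynomial.algHom_ext h)

theorem adjoin_range_coord : Algebra.adjoin k (Set.range A.coord) = ⊤ := by
  have hrange : Set.range A.coord = A.toCoordRing '' Set.range MvPolynomial.X :=
    Set.range_comp _ _
  rw [hrange, ← AlgHom.map_adjoin, MvPolynomial.adjoin_range_X, Algebra.map_top,
    AlgHom.range_eq_top]
  exact Ideal.Quotient.mkₐ_surjective k _

variable {Q : Type*} [CommRing Q] [Algebra k Q] (l : Module.Dual k V →ₗ[k] Q)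

theorem isUnit_lift_of_mem_denominators (hl : ∀ i, IsUnit (l (A.a i))) (y : A.denominators) :
    IsUnit (SymmetricAlgebra.lift l y) := by
  have hle : A.denominators ≤ (IsUnit.submonoid Q).comap (SymmetricAlgebra.lift l) := by
    refine Submonoid.closure_le.2 ?_
    rintro _ ⟨i, rfl⟩
    simpa [IsUnit.mem_submonoid_iff] using hl i
  exact hle y.2

/-- The universal property of the complement: a `Q`-valued point of `V` at which the functionals
`a i` are invertible. -/
def complementLift (hl : ∀ i, IsUnit (l (A.a i))) : A.complementAlgebra →ₐ[k] Q :=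
  IsLocalization.liftAlgHom (A.isUnit_lift_of_mem_denominators l hl)

theorem complementLift_linearFunction (hl : ∀ i, IsUnit (l (A.a i))) (m : Module.Dual k V) :
    A.complementLift l hl (A.linearFunction m) = l m :=
  (IsLocalization.lift_eq (g := (SymmetricAlgebra.lift l).toRingHom) _ _).trans
    (SymmetricAlgebra.lift_ι_apply l m)

theorem mul_complementLift_coord (hl : ∀ i, IsUnit (l (A.a i))) (i : I) :
    l (A.a i) * A.complementLift l hl (A.toComplementRing (A.coord i)) = 1 := by
  rw [← A.complementLift_linearFunction l hl, ← map_mul, linearFunction_mul_coord, map_one]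

end Complement

section CoordLift

variable {B Q : Type*} [CommRing B] [CommRing Q] [Algebra k B] [Algebra k Q] {j : B →ₐ[k] Q}
  {l : Module.Dual k V →ₗ[k] Q}

variable {A} in
theorem isUnit_apply_of_exists_mul_eq_one (h : ∀ i, ∃ b, l (A.a i) * j b = 1) (i : I) :
    IsUnit (l (A.a i)) :=
  (h i).elim fun _ hb => .of_mul_eq_one _ hb

theorem complementLift_mem_range (h : ∀ i, ∃ b, l (A.a i) * j b = 1) (x : A.coordRing) :
    A.complementLift l (isUnit_apply_of_exists_mul_eq_one h) (A.toComplementRing x) ∈ j.range := by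
  set e := A.complementLift l (isUnit_apply_of_exists_mul_eq_one h)
  have hle : Algebra.adjoin k (Set.range A.coord) ≤ j.range.comap (e.comp A.toComplementRing) := by
    refine Algebra.adjoin_le ?_
    rintro _ ⟨i, rfl⟩
    obtain ⟨b, hb⟩ := h i
    exact ⟨b, (IsUnit.of_mul_eq_one _ hb).mul_left_cancel
      (hb.trans (A.mul_complementLift_coord l (isUnit_apply_of_exists_mul_eq_one h) i).symm)⟩
  exact hle (A.adjoin_range_coord ▸ Algebra.mem_top)

/-- A `Q`-valued point `l` of the complement whose reciprocal coordinates lie in a subring `B` of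
`Q` defines a `B`-valued point of the reciprocal plane. -/
def coordLift (hj : Function.Injective j) (h : ∀ i, ∃ b, l (A.a i) * j b = 1) :
    A.coordRing →ₐ[k] B :=
  (AlgEquiv.ofInjective j hj).symm.toAlgHom.comp
    (((A.complementLift l (isUnit_apply_of_exists_mul_eq_one h)).comp
      A.toComplementRing).codRestrict j.range (A.complementLift_mem_range h))

theorem mul_coordLift_coord (hj : Function.Injective j) (h : ∀ i, ∃ b, l (A.a i) * j b = 1)
    (i : I) : l (A.a i) * j (A.coordLift hj h (A.coord i)) = 1 := by
  have hmap : j (A.coordLift hj h (A.coord i)) =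
      A.complementLift l (isUnit_apply_of_exists_mul_eq_one h) (A.toComplementRing (A.coord i)) :=
    congrArg Subtype.val ((AlgEquiv.ofInjective j hj).apply_symm_apply _)
  rw [hmap, mul_complementLift_coord]

end CoordLift

section CoordLiftAway

variable {B Q : Type*} [CommRing B] [CommRing Q] [Algebra k B] [Algebra k Q] {t : B →ₐ[k] Q}
  {l : Module.Dual k V →ₗ[k] Q} {b : B}

/-- A point `l` of the complement with values in an extension `Q` of `B`, whose reciprocal
coordinates are fractions `n / d` of elements of `B` with `d` dividing `b`, defines a point of the
reciprocal plane with values in the localization of `B` away from `b`. -/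
def coordLiftAway (ht : Function.Injective t)
    (h : ∀ i, ∃ n d, d ∣ b ∧ l (A.a i) * t n = t d) : A.coordRing →ₐ[k] Localization.Away b :=
  A.coordLift (j := IsLocalization.Away.mapₐ (Localization.Away b) (Localization.Away (t b)) t b)
    (l := (IsScalarTower.toAlgHom k Q (Localization.Away (t b))).toLinearMap ∘ₗ l)
    (IsLocalization.Away.mapₐ_injective_of_injective b ht) fun i => exists_mul_awayMapₐ_eq_one (h i)

theorem coordLiftAway_coord_mul (ht : Function.Injective t)
    (h : ∀ i, ∃ n d, d ∣ b ∧ l (A.a i) * t n = t d) {i : I} {n d : B}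
    (hnd : l (A.a i) * t n = t d) :
    A.coordLiftAway ht h (A.coord i) * algebraMap B _ d = algebraMap B _ n := by
  set j := IsLocalization.Away.mapₐ (Localization.Away b) (Localization.Away (t b)) t b
  have hj : Function.Injective j := IsLocalization.Away.mapₐ_injective_of_injective b ht
  have hl : algebraMap Q (Localization.Away (t b)) (l (A.a i)) *
      j (A.coordLiftAway ht h (A.coord i)) = 1 :=
    A.mul_coordLift_coord
      (l := (IsScalarTower.toAlgHom k Q (Localization.Away (t b))).toLinearMap ∘ₗ l) hj
      (fun i => exists_mul_awayMapₐ_eq_one (h i)) i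
  apply hj
  rw [map_mul, awayMapₐ_algebraMap, awayMapₐ_algebraMap, ← hnd, map_mul, ← mul_assoc,
    mul_comm (j _), hl, one_mul]

end CoordLiftAway

/-! ### Splitting the dual space along a flat -/

section Flat

variable (F : Set I)

/-- The span of the functionals indexed by `F`, the annihilator of `V^F`. -/
abbrev flatSpan : Submodule k (Module.Dual k V) :=
  Submodule.span k (A.a '' F)

/-- A functional indexed by `F`, as an element of the span. -/
def flatFunctional (i : F) : A.flatSpan F :=
  ⟨A.a i, Submodule.subset_span (Set.mem_image_of_mem _ i.2)⟩

variable {A F} in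
theorem flatSpan_linearMap_ext {M : Type*} [AddCommMonoid M] [Module k M]
    {f g : A.flatSpan F →ₗ[k] M}
    (h : ∀ i, f (A.flatFunctional F i) = g (A.flatFunctional F i)) : f = g := by
  refine LinearMap.ext_on_range (v := A.flatFunctional F) ?_ h
  apply Submodule.map_injective_of_injective (A.flatSpan F).injective_subtype
  rw [Submodule.map_span, Submodule.map_top, Submodule.range_subtype, ← Set.range_comp]
  exact congrArg _ (Set.image_eq_range _ _).symm

theorem dualAnnihilator_flatSpace : (A.flatSpace F).dualAnnihilator = A.flatSpan F :=
  Subspace.dualCoannihilator_dualAnnihilator_eq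

theorem dualRestrict_apply_of_mem (i : F) : (A.flatSpace F).dualRestrict (A.a i) = 0 := by
  rw [← LinearMap.mem_ker, Submodule.dualRestrict_ker_eq_dualAnnihilator,
    dualAnnihilator_flatSpace]
  exact (A.flatFunctional F i).2

theorem sub_dualLift_mem_flatSpan (m : Module.Dual k V) :
    m - Subspace.dualLift (A.flatSpace F) ((A.flatSpace F).dualRestrict m) ∈ A.flatSpan F := by
  rw [← dualAnnihilator_flatSpace, ← Submodule.dualRestrict_ker_eq_dualAnnihilator,
    LinearMap.mem_ker, map_sub, sub_eq_zero]
  exact (LinearMap.congr_fun (Subspace.dualRestrict_comp_dualLift (A.flatSpace F)) _).symm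

/-- The projection of the dual space onto the span of `F` whose kernel is the space of chosen
extensions to `V` of the functionals on `V^F`. -/
def flatProjection : Module.Dual k V →ₗ[k] A.flatSpan F :=
  (LinearMap.id - Subspace.dualLift (A.flatSpace F) ∘ₗ (A.flatSpace F).dualRestrict).codRestrict
    (A.flatSpan F) (A.sub_dualLift_mem_flatSpan F)

theorem dualLift_dualRestrict (m : Module.Dual k V) :
    Subspace.dualLift (A.flatSpace F) ((A.flatSpace F).dualRestrict m) = m - A.flatProjection F m :=
  (sub_sub_cancel m _).symm

theorem flatProjection_apply_of_mem (i : F) :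
    A.flatProjection F (A.a i) = A.flatFunctional F i := by
  apply Subtype.ext
  change A.a i - Subspace.dualLift (A.flatSpace F) ((A.flatSpace F).dualRestrict (A.a i)) = A.a i
  rw [dualRestrict_apply_of_mem, map_zero, sub_zero]

/-- The product of the coordinates indexed by `F`, a common denominator of the functionals in
the span of `F`. -/
def flatCoordProd : A.coordRing :=
  ∏ᶠ i : F, A.coord i

theorem coord_dvd_flatCoordProd (i : F) : A.coord i ∣ A.flatCoordProd F :=
  finprod_mem_dvd i (hasFiniteMulSupport_of_finite fun i : F => A.coord i)

theorem flatCoordProd_mul_linearFunction_mem_range (l : A.flatSpan F) :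
    A.toComplementRing (A.flatCoordProd F) * A.linearFunction l ∈
      LinearMap.range A.toComplementRing.toLinearMap := by
  suffices hle : A.flatSpan F ≤ (LinearMap.range A.toComplementRing.toLinearMap).comap
      (LinearMap.mulLeft k (A.toComplementRing (A.flatCoordProd F)) ∘ₗ A.linearFunction) from
    hle l.2
  refine Submodule.span_le.2 ?_
  rintro _ ⟨i, hi, rfl⟩
  obtain ⟨c, hc⟩ := A.coord_dvd_flatCoordProd F ⟨i, hi⟩
  refine ⟨c, ?_⟩
  change A.toComplementRing c =
    A.toComplementRing (A.flatCoordProd F) * A.linearFunction (A.a i)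
  rw [hc, map_mul, mul_right_comm, mul_comm _ (A.linearFunction _), linearFunction_mul_coord,
    one_mul]

/-- A functional in the span of `F`, multiplied by the coordinates indexed by `F`, as a regular
function on the reciprocal plane. -/
def flatNumerator : A.flatSpan F →ₗ[k] A.coordRing :=
  (LinearMap.mulLeft k (A.toComplementRing (A.flatCoordProd F)) ∘ₗ A.linearFunction ∘ₗ
    (A.flatSpan F).subtype).codRestrictOfInjective A.toComplementRing.toLinearMap
      A.toComplementRing_injective (A.flatCoordProd_mul_linearFunction_mem_range F)

theorem toComplementRing_flatNumerator (l : A.flatSpan F) :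
    A.toComplementRing (A.flatNumerator F l) =
      A.toComplementRing (A.flatCoordProd F) * A.linearFunction l :=
  LinearMap.codRestrictOfInjective_comp_apply _ A.toComplementRing.toLinearMap _ _ l

theorem flatNumerator_mul_coord (i : F) :
    A.flatNumerator F (A.flatFunctional F i) * A.coord i = A.flatCoordProd F := by
  apply A.toComplementRing_injective
  rw [map_mul, toComplementRing_flatNumerator, mul_assoc]
  exact (congrArg _ (A.linearFunction_mul_coord i)).trans (mul_one _)

variable {F}
variable {B C : Type*} [CommRing B] [CommRing C] [Algebra k B] [Algebra k C]
  (f : A.coordRing →ₐ[k] B)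

variable {A f} in
theorem isUnit_map_flatCoordProd_iff :
    IsUnit (f (A.flatCoordProd F)) ↔ ∀ i : F, IsUnit (f (A.coord i)) :=
  isUnit_map_finprod_iff f _

variable (F) in
/-- A functional in the span of `F`, as a function on a scheme over the reciprocal plane on which
the coordinates indexed by `F` are invertible (where they are not, its value is zero). -/
def flatFunction : A.flatSpan F →ₗ[k] B :=
  LinearMap.mulLeft k (Ring.inverse (f (A.flatCoordProd F))) ∘ₗ f.toLinearMap ∘ₗ A.flatNumerator F

variable {f} (hf : ∀ i : F, IsUnit (f (A.coord i)))
include hf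

theorem flatCoordProd_mul_flatFunction (l : A.flatSpan F) :
    f (A.flatCoordProd F) * A.flatFunction F f l = f (A.flatNumerator F l) :=
  Ring.mul_inverse_cancel_left _ _ (isUnit_map_flatCoordProd_iff.2 hf)

theorem flatFunction_mul_coord (i : F) :
    A.flatFunction F f (A.flatFunctional F i) * f (A.coord i) = 1 := by
  apply (isUnit_map_flatCoordProd_iff.2 hf).mul_left_cancel
  rw [← mul_assoc, flatCoordProd_mul_flatFunction A hf, ← map_mul, flatNumerator_mul_coord, mul_one]

theorem map_flatFunction (g : B →ₐ[k] C) {f' : A.coordRing →ₐ[k] C}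
    (h : ∀ i : F, f' (A.coord i) = g (f (A.coord i))) (l : A.flatSpan F) :
    g (A.flatFunction F f l) = A.flatFunction F f' l := by
  have hf' (i : F) : IsUnit (f' (A.coord i)) := h i ▸ (hf i).map g
  have heq : g.toLinearMap ∘ₗ A.flatFunction F f = A.flatFunction F f' :=
    flatSpan_linearMap_ext fun i => (hf' i).mul_right_cancel <| by
      rw [flatFunction_mul_coord A hf', h, LinearMap.comp_apply, AlgHom.toLinearMap_apply,
        ← map_mul, flatFunction_mul_coord A hf, map_one]
  exact LinearMap.congr_fun heq l

end Flat

/-- Evaluation at the origin, as a homomorphism of algebras. -/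
def evalZeroₐ : A.coordRing →ₐ[k] k :=
  { A.evalZero with commutes' := fun r => MvPolynomial.constantCoeff_C (σ := I) r }

theorem evalZeroₐ_coord (i : I) : A.evalZeroₐ (A.coord i) = 0 :=
  MvPolynomial.constantCoeff_X (R := k) i

section Translate

variable (F : Set I) (hF : A.matroid.IsFlat F) {S : Type*} [CommRing S] [Algebra k S]
  (f : A.coordRing →ₐ[k] S)

/-- The component `c_j` in the span of `F` of a functional `a j` with `j ∉ F`, as a function on a
scheme over the open star of `F`. -/
def shift (j : (Fᶜ : Set I)) : S :=
  A.flatFunction F f (A.flatProjection F (A.a j))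

/-- The function `1 + c_j w_j` on the product of `X_{A^F}`, with coordinates `w_j`, and a scheme
over the open star of `F`. -/
def translateFactor (j : (Fᶜ : Set I)) : (A.restriction F hF).coordRing ⊗[k] S :=
  1 + (A.restriction F hF).coord j ⊗ₜ A.shift F f j

/-- The product of the functions `1 + c_j w_j`. -/
def translateDenom : (A.restriction F hF).coordRing ⊗[k] S :=
  ∏ᶠ j, A.translateFactor F hF f j

theorem translateFactor_dvd_translateDenom (j : (Fᶜ : Set I)) :
    A.translateFactor F hF f j ∣ A.translateDenom F hF f :=
  finprod_mem_dvd j (hasFiniteMulSupport_of_finite _)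

/-- The inclusion of functions on `X_{A^F} × Spec S` into those on `U_{A^F} × Spec S`. -/
def toComplementTensor : (A.restriction F hF).coordRing ⊗[k] S →ₐ[k]
    (A.restriction F hF).complementAlgebra ⊗[k] S :=
  Algebra.TensorProduct.map (A.restriction F hF).toComplementRing (AlgHom.id k S)

theorem toComplementTensor_injective :
    Function.Injective (A.toComplementTensor F hF (S := S)) :=
  Module.Flat.rTensor_preserves_injective_linearMap
    (A.restriction F hF).toComplementRing.toLinearMap
    (A.restriction F hF).toComplementRing_injective

/-- The point `v + s` of `V` with `v` in the complement of the restriction and `s` the point of the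
dual of the span of `F` given by `f`, where `V` is split as `V^F` and this dual. -/
def translateLinear :
    Module.Dual k V →ₗ[k] (A.restriction F hF).complementAlgebra ⊗[k] S :=
  Algebra.TensorProduct.includeLeft.toLinearMap ∘ₗ (A.restriction F hF).linearFunction ∘ₗ
      (A.flatSpace F).dualRestrict +
    Algebra.TensorProduct.includeRight.toLinearMap ∘ₗ A.flatFunction F f ∘ₗ A.flatProjection F

theorem translateLinear_apply (m : Module.Dual k V) :
    A.translateLinear F hF f m =
      (A.restriction F hF).linearFunction ((A.flatSpace F).dualRestrict m) ⊗ₜ 1 +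
        1 ⊗ₜ A.flatFunction F f (A.flatProjection F m) :=
  rfl

variable {F f}

theorem translateLinear_mul_of_mem (hf : ∀ i : F, IsUnit (f (A.coord i))) (i : F) :
    A.translateLinear F hF f (A.a i) * A.toComplementTensor F hF (1 ⊗ₜ f (A.coord i)) =
      A.toComplementTensor F hF 1 := by
  rw [translateLinear_apply, dualRestrict_apply_of_mem, map_zero, TensorProduct.zero_tmul,
    zero_add, flatProjection_apply_of_mem, toComplementTensor, Algebra.TensorProduct.map_tmul,
    map_one, AlgHom.id_apply, Algebra.TensorProduct.tmul_mul_tmul, flatFunction_mul_coord A hf,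
    one_mul, map_one, Algebra.TensorProduct.one_def]

theorem translateLinear_mul_of_notMem (j : (Fᶜ : Set I)) :
    A.translateLinear F hF f (A.a j) *
        A.toComplementTensor F hF ((A.restriction F hF).coord j ⊗ₜ 1) =
      A.toComplementTensor F hF (A.translateFactor F hF f j) := by
  have hrestrict : (A.restriction F hF).linearFunction ((A.flatSpace F).dualRestrict (A.a j)) *
      (A.restriction F hF).toComplementRing ((A.restriction F hF).coord j) = 1 :=
    (A.restriction F hF).linearFunction_mul_coord j
  rw [translateLinear_apply, translateFactor, toComplementTensor, map_add, map_one,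
    Algebra.TensorProduct.map_tmul, Algebra.TensorProduct.map_tmul, add_mul,
    Algebra.TensorProduct.tmul_mul_tmul, Algebra.TensorProduct.tmul_mul_tmul, hrestrict, map_one,
    one_mul, one_mul, mul_one, AlgHom.id_apply, Algebra.TensorProduct.one_def, shift]

variable (hf : ∀ i : F, IsUnit (f (A.coord i)))
include hf

theorem exists_translateLinear_mul (i : I) : ∃ n d, d ∣ A.translateDenom F hF f ∧
    A.translateLinear F hF f (A.a i) * A.toComplementTensor F hF n =
      A.toComplementTensor F hF d := by
  by_cases hi : i ∈ F
  · exact ⟨_, 1, one_dvd _, A.translateLinear_mul_of_mem hF hf ⟨i, hi⟩⟩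
  · exact ⟨_, _, A.translateFactor_dvd_translateDenom F hF f ⟨i, hi⟩,
      A.translateLinear_mul_of_notMem hF ⟨i, hi⟩⟩

/-- The map `(w, s) ↦ u` to `X_A` from an open part of the product of `X_{A^F}` and a scheme over
the open star of `F`, with `u_i = s_i` for `i ∈ F` and `u_j = w_j / (1 + c_j w_j)` for `j ∉ F`. -/
def translate : A.coordRing →ₐ[k] Localization.Away (A.translateDenom F hF f) :=
  A.coordLiftAway (A.toComplementTensor_injective F hF) (A.exists_translateLinear_mul hF hf)

theorem translate_coord_of_mem (i : F) :
    A.translate hF hf (A.coord i) = algebraMap _ _ ((1 : (A.restriction F hF).coordRing) ⊗ₜ[k]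
      f (A.coord i)) := by
  have h := A.coordLiftAway_coord_mul (A.toComplementTensor_injective F hF)
    (A.exists_translateLinear_mul hF hf) (A.translateLinear_mul_of_mem hF hf i)
  rwa [map_one, mul_one] at h

theorem translate_coord_mul_of_notMem (j : (Fᶜ : Set I)) :
    A.translate hF hf (A.coord j) * algebraMap _ _ (A.translateFactor F hF f j) =
      algebraMap _ _ ((A.restriction F hF).coord j ⊗ₜ[k] (1 : S)) :=
  A.coordLiftAway_coord_mul _ _ (A.translateLinear_mul_of_notMem hF j)

end Translate

section Retract

variable {F : Set I} (hF : A.matroid.IsFlat F) {S : Type*} [CommRing S] [Algebra k S]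
  {f : A.coordRing →ₐ[k] S}

/-- The inclusion of `Spec S` as the fibre at the origin of `X_{A^F} × Spec S`. -/
def evalZeroTensor : (A.restriction F hF).coordRing ⊗[k] S →ₐ[k] S :=
  Algebra.TensorProduct.lift ((Algebra.ofId k S).comp (A.restriction F hF).evalZeroₐ)
    (AlgHom.id k S) fun _ _ => .all _ _

theorem evalZeroTensor_coord_tmul (j : (Fᶜ : Set I)) (s : S) :
    A.evalZeroTensor hF ((A.restriction F hF).coord j ⊗ₜ s) = 0 := by
  simp [evalZeroTensor, evalZeroₐ_coord]

theorem evalZeroTensor_one_tmul (s : S) : A.evalZeroTensor hF (1 ⊗ₜ s) = s := by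
  simp [evalZeroTensor]

theorem evalZeroTensor_comp_includeLeft :
    (A.evalZeroTensor hF (S := S)).comp Algebra.TensorProduct.includeLeft =
      (Algebra.ofId k S).comp (A.restriction F hF).evalZeroₐ :=
  Algebra.TensorProduct.lift_comp_includeLeft _ _ _

theorem evalZeroTensor_comp_includeRight :
    (A.evalZeroTensor hF (S := S)).comp Algebra.TensorProduct.includeRight = AlgHom.id k S :=
  AlgHom.ext (A.evalZeroTensor_one_tmul hF)

theorem evalZeroTensor_translateFactor (j : (Fᶜ : Set I)) :
    A.evalZeroTensor hF (A.translateFactor F hF f j) = 1 := by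
  rw [translateFactor, map_add, map_one, evalZeroTensor_coord_tmul, add_zero]

theorem isUnit_evalZeroTensor_translateDenom :
    IsUnit (A.evalZeroTensor hF (A.translateDenom F hF f)) :=
  (isUnit_map_finprod_iff _ _).2 fun j => by
    rw [evalZeroTensor_translateFactor]
    exact isUnit_one

variable (hf : ∀ i : F, IsUnit (f (A.coord i)))

/-- A point of the open star of `F`, with the coordinates that are not indexed by `F` replaced by
zero. -/
def retract : A.coordRing →ₐ[k] S :=
  (IsLocalization.Away.liftAlgHom (A.translateDenom F hF f)
    (A.isUnit_evalZeroTensor_translateDenom hF)).comp (A.translate hF hf)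

theorem retract_coord_of_mem (i : F) : A.retract hF hf (A.coord i) = f (A.coord i) := by
  rw [retract, AlgHom.comp_apply, translate_coord_of_mem,
    awayLiftAlgHom_algebraMap _ (A.isUnit_evalZeroTensor_translateDenom hF),
    evalZeroTensor_one_tmul]

theorem retract_coord_of_notMem (j : (Fᶜ : Set I)) : A.retract hF hf (A.coord j) = 0 := by
  have hcoord := congrArg (IsLocalization.Away.liftAlgHom (A.translateDenom F hF f)
    (A.isUnit_evalZeroTensor_translateDenom hF)) (A.translate_coord_mul_of_notMem hF hf j)
  rwa [map_mul, awayLiftAlgHom_algebraMap, awayLiftAlgHom_algebraMap,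
    evalZeroTensor_translateFactor, mul_one, evalZeroTensor_coord_tmul] at hcoord

end Retract

/-! ### Retraction to the stratum -/

section Stratum

variable (F : Set I)

instance : Algebra k (A.closedStratumRing F) :=
  Ideal.Quotient.algebra k

/-- The multiplicative set generated by the coordinates indexed by `F`, which are inverted on the
stratum. -/
abbrev stratumDenominators : Submonoid (A.closedStratumRing F) :=
  Submonoid.closure (Set.range fun i : F => A.toClosedStratumRing F (A.coord i))

/-- The restriction of functions from the reciprocal plane to the stratum. -/
def toStratumRing : A.coordRing →ₐ[k] A.stratumRing F :=
  (IsScalarTower.toAlgHom k (A.closedStratumRing F) (A.stratumRing F)).comp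
    (Ideal.Quotient.mkₐ k (A.stratumIdeal F))

theorem isUnit_toStratumRing_coord (i : F) : IsUnit (A.toStratumRing F (A.coord i)) :=
  IsLocalization.map_units (A.stratumRing F)
    (⟨_, Submonoid.subset_closure ⟨i, rfl⟩⟩ : A.stratumDenominators F)

theorem toStratumRing_coord_eq_zero (j : (Fᶜ : Set I)) : A.toStratumRing F (A.coord j) = 0 := by
  have hzero : A.toClosedStratumRing F (A.coord j) = 0 := Ideal.Quotient.eq_zero_iff_mem.2
    (Ideal.le_radical (Ideal.subset_span (Set.mem_image_of_mem _ j.2)))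
  exact (congrArg (algebraMap _ (A.stratumRing F)) hzero).trans (map_zero _)

variable {A F} in
theorem stratumRing_algHom_ext {B : Type*} [CommRing B] [Algebra k B]
    {f g : A.stratumRing F →ₐ[k] B}
    (h : ∀ i : F, f (A.toStratumRing F (A.coord i)) = g (A.toStratumRing F (A.coord i))) :
    f = g := by
  have hcomp : f.comp (A.toStratumRing F) = g.comp (A.toStratumRing F) := by
    refine coordRing_algHom_ext fun i => ?_
    rw [AlgHom.comp_apply, AlgHom.comp_apply]
    by_cases hi : i ∈ F
    · exact h ⟨i, hi⟩
    · rw [A.toStratumRing_coord_eq_zero F ⟨i, hi⟩, map_zero, map_zero]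
  exact IsLocalization.algHom_ext (A.stratumDenominators F) (Ideal.Quotient.algHom_ext _ hcomp)

variable {F} (hF : A.matroid.IsFlat F) {S : Type*} [CommRing S] [Algebra k S]
  [_root_.IsReduced S] {f : A.coordRing →ₐ[k] S} (hf : ∀ i : F, IsUnit (f (A.coord i)))

theorem stratumIdeal_le_ker_retract : A.stratumIdeal F ≤ RingHom.ker (A.retract hF hf) := by
  have hspan : Ideal.span (A.coord '' Fᶜ) ≤ RingHom.ker (A.retract hF hf) := by
    refine Ideal.span_le.2 ?_
    rintro _ ⟨j, hj, rfl⟩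
    exact A.retract_coord_of_notMem hF hf ⟨j, hj⟩
  rintro x ⟨n, hn⟩
  have hpow : A.retract hF hf (x ^ n) = 0 := hspan hn
  rw [map_pow] at hpow
  exact eq_zero_of_pow_eq_zero hpow

/-- The retraction to the locus where the coordinates that are not indexed by `F` vanish. -/
def closedStratumLift : A.closedStratumRing F →ₐ[k] S :=
  Ideal.Quotient.liftₐ (A.stratumIdeal F) (A.retract hF hf) (A.stratumIdeal_le_ker_retract hF hf)

theorem closedStratumLift_coord (i : F) :
    A.closedStratumLift hF hf (A.toClosedStratumRing F (A.coord i)) = f (A.coord i) :=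
  A.retract_coord_of_mem hF hf i

theorem isUnit_closedStratumLift (y : A.stratumDenominators F) :
    IsUnit (A.closedStratumLift hF hf y) := by
  have hle : A.stratumDenominators F ≤
      (IsUnit.submonoid S).comap (A.closedStratumLift hF hf) := by
    refine Submonoid.closure_le.2 ?_
    rintro _ ⟨i, rfl⟩
    change IsUnit (A.closedStratumLift hF hf _)
    rw [closedStratumLift_coord]
    exact hf i
  exact hle y.2

/-- The retraction to the stratum of a reduced affine scheme over the open star of `F`. -/
def stratumLift : A.stratumRing F →ₐ[k] S :=
  IsLocalization.liftAlgHom (A.isUnit_closedStratumLift hF hf)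

theorem stratumLift_coord (i : F) :
    A.stratumLift hF hf (A.toStratumRing F (A.coord i)) = f (A.coord i) :=
  (IsLocalization.lift_eq (g := (A.closedStratumLift hF hf).toRingHom) _ _).trans
    (A.closedStratumLift_coord hF hf i)

end Stratum

/-! ### The chart around the stratum -/

section SliceFactor

variable (F : Set I)

/-- The function `1 - c_j u_j` on an affine scheme over the open star of `F`. -/
def sliceFactor {S : Type*} [CommRing S] [Algebra k S] (f : A.coordRing →ₐ[k] S)
    (j : (Fᶜ : Set I)) : S :=
  1 - A.shift F f j * f (A.coord j)

/-- The function `1 - c_j u_j`, multiplied by the coordinates indexed by `F` to become regular on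
the reciprocal plane. -/
def sliceNumerator (j : (Fᶜ : Set I)) : A.coordRing :=
  A.flatCoordProd F - A.flatNumerator F (A.flatProjection F (A.a j)) * A.coord j

/-- A function that is invertible where the coordinates indexed by `F` and the functions
`1 - c_j u_j` are. -/
def sliceDenom : A.coordRing :=
  A.flatCoordProd F * ∏ᶠ j, A.sliceNumerator F j

theorem sliceNumerator_dvd_sliceDenom (j : (Fᶜ : Set I)) :
    A.sliceNumerator F j ∣ A.sliceDenom F :=
  (finprod_mem_dvd j (hasFiniteMulSupport_of_finite _)).mul_left _

theorem coord_dvd_sliceDenom (i : F) : A.coord i ∣ A.sliceDenom F :=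
  (A.coord_dvd_flatCoordProd F i).mul_right _

variable {F} {S T : Type*} [CommRing S] [CommRing T] [Algebra k S] [Algebra k T]
  {f : A.coordRing →ₐ[k] S} (hf : ∀ i : F, IsUnit (f (A.coord i)))
include hf

theorem map_shift (g : S →ₐ[k] T) {f' : A.coordRing →ₐ[k] T}
    (h : ∀ i : F, f' (A.coord i) = g (f (A.coord i))) (j : (Fᶜ : Set I)) :
    g (A.shift F f j) = A.shift F f' j :=
  A.map_flatFunction hf g h _

theorem map_sliceNumerator (j : (Fᶜ : Set I)) :
    f (A.sliceNumerator F j) = f (A.flatCoordProd F) * A.sliceFactor F f j := by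
  rw [sliceNumerator, map_sub, map_mul, ← flatCoordProd_mul_flatFunction A hf, sliceFactor, shift,
    mul_sub, mul_one, mul_assoc]

theorem isUnit_map_sliceDenom (h : ∀ j, IsUnit (A.sliceFactor F f j)) :
    IsUnit (f (A.sliceDenom F)) := by
  have hP : IsUnit (f (A.flatCoordProd F)) := isUnit_map_flatCoordProd_iff.2 hf
  rw [sliceDenom, map_mul]
  exact hP.mul ((isUnit_map_finprod_iff f _).2 fun j =>
    (A.map_sliceNumerator hf j).symm ▸ hP.mul (h j))

variable (hF : A.matroid.IsFlat F)

theorem isUnit_translate_coord (i : F) : IsUnit (A.translate hF hf (A.coord i)) := by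
  rw [translate_coord_of_mem]
  exact ((hf i).map Algebra.TensorProduct.includeRight).map
    (algebraMap _ (Localization.Away (A.translateDenom F hF f)))

theorem sliceFactor_translate_mul (j : (Fᶜ : Set I)) :
    A.sliceFactor F (A.translate hF hf) j * algebraMap _ _ (A.translateFactor F hF f j) = 1 := by
  let g : S →ₐ[k] Localization.Away (A.translateDenom F hF f) :=
    (IsScalarTower.toAlgHom k ((A.restriction F hF).coordRing ⊗[k] S) _).comp
      Algebra.TensorProduct.includeRight
  have hshift : algebraMap _ _ ((1 : (A.restriction F hF).coordRing) ⊗ₜ[k] A.shift F f j) =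
      A.shift F (A.translate hF hf) j :=
    A.map_shift hf g (A.translate_coord_of_mem hF hf) j
  have hfactor : algebraMap _ (Localization.Away (A.translateDenom F hF f))
      (A.translateFactor F hF f j) =
        1 + algebraMap _ _ ((A.restriction F hF).coord j ⊗ₜ[k] (1 : S)) *
          A.shift F (A.translate hF hf) j := by
    rw [translateFactor, map_add, map_one, ← hshift, ← map_mul]
    exact congrArg (fun t => 1 + algebraMap _ _ t) (tmul_one_mul_one_tmul _ _).symm
  rw [sliceFactor]
  linear_combination hfactor -
    A.shift F (A.translate hF hf) j * A.translate_coord_mul_of_notMem hF hf j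

theorem isUnit_translate_sliceDenom : IsUnit (A.translate hF hf (A.sliceDenom F)) :=
  A.isUnit_map_sliceDenom (A.isUnit_translate_coord hf hF) fun j =>
    .of_mul_eq_one _ (A.sliceFactor_translate_mul hf hF j)

end SliceFactor

section Chart

variable (F : Set I)

/-- The coordinate ring of the open subscheme of the reciprocal plane that is mapped to
`X_{A^F} × X_{A,F}`. -/
abbrev chartRing : Type u :=
  Localization.Away (A.sliceDenom F)

/-- The restriction of functions from the reciprocal plane to the chart. -/
def toChartRing : A.coordRing →ₐ[k] A.chartRing F :=
  IsScalarTower.toAlgHom k A.coordRing (A.chartRing F)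

theorem isUnit_toChartRing_coord (i : F) : IsUnit (A.toChartRing F (A.coord i)) :=
  isUnit_of_dvd_unit (map_dvd (A.toChartRing F) (A.coord_dvd_sliceDenom F i))
    (IsLocalization.Away.algebraMap_isUnit (A.sliceDenom F))

instance : _root_.IsReduced (A.chartRing F) :=
  isReduced_localizationPreserves (Submonoid.powers (A.sliceDenom F)) _ inferInstance

variable {F} (hF : A.matroid.IsFlat F)

theorem linearFunction_dualLift_mul (j : (Fᶜ : Set I)) :
    (A.linearFunction ∘ₗ Subspace.dualLift (A.flatSpace F)) ((A.restriction F hF).a j) *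
        A.toComplementRing (A.flatCoordProd F * A.coord j) =
      A.toComplementRing (A.sliceNumerator F j) := by
  have hlift : Subspace.dualLift (A.flatSpace F) ((A.restriction F hF).a j) =
      A.a j - A.flatProjection F (A.a j) :=
    A.dualLift_dualRestrict F (A.a j)
  rw [LinearMap.comp_apply, hlift, map_sub, sliceNumerator, map_sub, map_mul, map_mul,
    toComplementRing_flatNumerator]
  linear_combination A.toComplementRing (A.flatCoordProd F) * A.linearFunction_mul_coord j

theorem exists_linearFunction_dualLift_mul (j : (Fᶜ : Set I)) :
    ∃ n d, d ∣ A.sliceDenom F ∧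
      (A.linearFunction ∘ₗ Subspace.dualLift (A.flatSpace F)) ((A.restriction F hF).a j) *
        A.toComplementRing n = A.toComplementRing d :=
  ⟨_, _, A.sliceNumerator_dvd_sliceDenom F j, A.linearFunction_dualLift_mul hF j⟩

/-- The map from the chart to `X_{A^F}` with coordinates `u_j / (1 - c_j u_j)`. -/
def chartFst : (A.restriction F hF).coordRing →ₐ[k] A.chartRing F :=
  (A.restriction F hF).coordLiftAway A.toComplementRing_injective
    (A.exists_linearFunction_dualLift_mul hF)

theorem chartFst_coord_mul (j : (Fᶜ : Set I)) :
    A.chartFst hF ((A.restriction F hF).coord j) * A.sliceFactor F (A.toChartRing F) j =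
      A.toChartRing F (A.coord j) := by
  have hlift : A.chartFst hF ((A.restriction F hF).coord j) *
      A.toChartRing F (A.sliceNumerator F j) =
        A.toChartRing F (A.flatCoordProd F * A.coord j) :=
    (A.restriction F hF).coordLiftAway_coord_mul A.toComplementRing_injective
      (A.exists_linearFunction_dualLift_mul hF) (A.linearFunction_dualLift_mul hF j)
  rw [A.map_sliceNumerator (A.isUnit_toChartRing_coord F), map_mul, mul_left_comm] at hlift
  exact (isUnit_map_flatCoordProd_iff.2 (A.isUnit_toChartRing_coord F)).mul_left_cancel hlift

/-- The map from the chart to the stratum with coordinates `u_i`. -/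
def chartSnd : A.stratumRing F →ₐ[k] A.chartRing F :=
  A.stratumLift hF (A.isUnit_toChartRing_coord F)

theorem chartSnd_coord (i : F) :
    A.chartSnd hF (A.toStratumRing F (A.coord i)) = A.toChartRing F (A.coord i) :=
  A.stratumLift_coord hF _ i

/-- The map from the chart to `X_{A^F} × X_{A,F}`. -/
def chartHom : (A.restriction F hF).coordRing ⊗[k] A.stratumRing F →ₐ[k] A.chartRing F :=
  Algebra.TensorProduct.lift (A.chartFst hF) (A.chartSnd hF) fun _ _ => .all _ _

theorem chartHom_tmul (r : (A.restriction F hF).coordRing) (s : A.stratumRing F) :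
    A.chartHom hF (r ⊗ₜ s) = A.chartFst hF r * A.chartSnd hF s :=
  Algebra.TensorProduct.lift_tmul _ _ _ _ _

/-- The denominator `∏ (1 + c_j w_j)` on the product `X_{A^F} × X_{A,F}`. -/
abbrev chartDenom : (A.restriction F hF).coordRing ⊗[k] A.stratumRing F :=
  A.translateDenom F hF (A.toStratumRing F)

theorem chartHom_translateFactor_mul (j : (Fᶜ : Set I)) :
    A.chartHom hF (A.translateFactor F hF (A.toStratumRing F) j) *
      A.sliceFactor F (A.toChartRing F) j = 1 := by
  have hshift : A.chartSnd hF (A.shift F (A.toStratumRing F) j) = A.shift F (A.toChartRing F) j :=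
    A.map_shift (A.isUnit_toStratumRing_coord F) _ (fun i => (A.chartSnd_coord hF i).symm) j
  have hfst := A.chartFst_coord_mul hF j
  rw [translateFactor, map_add, map_one, chartHom_tmul, hshift]
  rw [sliceFactor] at hfst ⊢
  linear_combination A.shift F (A.toChartRing F) j * hfst

theorem isUnit_chartHom_chartDenom : IsUnit (A.chartHom hF (A.chartDenom hF)) :=
  (isUnit_map_finprod_iff _ _).2 fun j => .of_mul_eq_one _ (A.chartHom_translateFactor_mul hF j)

/-- The map from the chart to the open subscheme of `X_{A^F} × X_{A,F}` where the functions
`1 + c_j w_j` are invertible. -/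
def chartLift : Localization.Away (A.chartDenom hF) →ₐ[k] A.chartRing F :=
  IsLocalization.Away.liftAlgHom (A.chartDenom hF) (A.isUnit_chartHom_chartDenom hF)

theorem chartLift_algebraMap (x) : A.chartLift hF (algebraMap _ _ x) = A.chartHom hF x :=
  awayLiftAlgHom_algebraMap _ (A.isUnit_chartHom_chartDenom hF) x

/-- The map `(w, s) ↦ u` to the reciprocal plane from the open subscheme of `X_{A^F} × X_{A,F}`
where the functions `1 + c_j w_j` are invertible. -/
abbrev stratumTranslate : A.coordRing →ₐ[k] Localization.Away (A.chartDenom hF) :=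
  A.translate hF (A.isUnit_toStratumRing_coord F)

/-- The inverse of the map from the chart to `X_{A^F} × X_{A,F}`. -/
def chartInv : A.chartRing F →ₐ[k] Localization.Away (A.chartDenom hF) :=
  IsLocalization.Away.liftAlgHom (A.sliceDenom F)
    (A.isUnit_translate_sliceDenom (A.isUnit_toStratumRing_coord F) hF)

theorem chartInv_toChartRing (x : A.coordRing) :
    A.chartInv hF (A.toChartRing F x) = A.stratumTranslate hF x :=
  awayLiftAlgHom_algebraMap _
    (A.isUnit_translate_sliceDenom (A.isUnit_toStratumRing_coord F) hF) x

theorem chartInv_sliceFactor (j : (Fᶜ : Set I)) :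
    A.chartInv hF (A.sliceFactor F (A.toChartRing F) j) =
      A.sliceFactor F (A.stratumTranslate hF) j := by
  rw [sliceFactor, map_sub, map_one, map_mul, chartInv_toChartRing, sliceFactor,
    A.map_shift (A.isUnit_toChartRing_coord F) _ fun i => (A.chartInv_toChartRing hF _).symm]

theorem chartInv_chartFst (j : (Fᶜ : Set I)) :
    A.chartInv hF (A.chartFst hF ((A.restriction F hF).coord j)) =
      algebraMap _ _ ((A.restriction F hF).coord j ⊗ₜ[k] (1 : A.stratumRing F)) := by
  have hslice := A.sliceFactor_translate_mul (A.isUnit_toStratumRing_coord F) hF j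
  have hfst := congrArg (A.chartInv hF) (A.chartFst_coord_mul hF j)
  have hcoord := A.translate_coord_mul_of_notMem hF (A.isUnit_toStratumRing_coord F) j
  rw [map_mul, chartInv_sliceFactor, chartInv_toChartRing] at hfst
  rw [← hcoord, ← hfst, mul_assoc, hslice, mul_one]

theorem chartInv_comp_chartLift : (A.chartInv hF).comp (A.chartLift hF) = AlgHom.id k _ := by
  refine IsLocalization.algHom_ext (Submonoid.powers (A.chartDenom hF)) ?_
  refine Algebra.TensorProduct.ext (coordRing_algHom_ext fun j => ?_)
    (stratumRing_algHom_ext fun i => ?_)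
  · change A.chartInv hF (A.chartLift hF (algebraMap _ _ (_ ⊗ₜ 1))) = _
    rw [chartLift_algebraMap, chartHom_tmul, map_one, mul_one, chartInv_chartFst]
    rfl
  · change A.chartInv hF (A.chartLift hF (algebraMap _ _ (1 ⊗ₜ _))) = _
    rw [chartLift_algebraMap, chartHom_tmul, map_one, one_mul, chartSnd_coord,
      chartInv_toChartRing, translate_coord_of_mem]
    rfl

theorem chartLift_stratumTranslate_coord (i : I) :
    A.chartLift hF (A.stratumTranslate hF (A.coord i)) = A.toChartRing F (A.coord i) := by
  by_cases hi : i ∈ F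
  · rw [A.translate_coord_of_mem hF _ ⟨i, hi⟩, chartLift_algebraMap, chartHom_tmul, map_one,
      one_mul, chartSnd_coord]
  · have hcoord := congrArg (A.chartLift hF)
      (A.translate_coord_mul_of_notMem hF (A.isUnit_toStratumRing_coord F) ⟨i, hi⟩)
    rw [map_mul, chartLift_algebraMap, chartLift_algebraMap, chartHom_tmul, map_one,
      mul_one] at hcoord
    rw [← A.chartFst_coord_mul hF ⟨i, hi⟩, ← hcoord, mul_assoc, chartHom_translateFactor_mul,
      mul_one]

theorem chartLift_comp_chartInv : (A.chartLift hF).comp (A.chartInv hF) = AlgHom.id k _ := by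
  refine IsLocalization.algHom_ext (Submonoid.powers (A.sliceDenom F)) ?_
  refine coordRing_algHom_ext fun i => ?_
  change A.chartLift hF (A.chartInv hF (A.toChartRing F (A.coord i))) = A.toChartRing F (A.coord i)
  rw [chartInv_toChartRing, chartLift_stratumTranslate_coord]

/-- The chart is isomorphic to the open subscheme of `X_{A^F} × X_{A,F}` where the functions
`1 + c_j w_j` are invertible. -/
def chartEquiv : Localization.Away (A.chartDenom hF) ≃ₐ[k] A.chartRing F :=
  AlgEquiv.ofAlgHom (A.chartLift hF) (A.chartInv hF) (A.chartLift_comp_chartInv hF)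
    (A.chartInv_comp_chartLift hF)

theorem isOpenImmersion_specMapAlgHom_chartHom :
    IsOpenImmersion (specMapAlgHom (A.chartHom hF)) :=
  isOpenImmersion_specMapAlgHom_of_algEquiv _ _ (A.chartEquiv hF) (A.chartLift_algebraMap hF)

end Chart

section ChartSection

variable {F : Set I}

theorem sliceFactor_toStratumRing (j : (Fᶜ : Set I)) :
    A.sliceFactor F (A.toStratumRing F) j = 1 := by
  rw [sliceFactor, toStratumRing_coord_eq_zero, mul_zero, sub_zero]

theorem isUnit_toStratumRing_sliceDenom : IsUnit (A.toStratumRing F (A.sliceDenom F)) :=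
  A.isUnit_map_sliceDenom (A.isUnit_toStratumRing_coord F) fun j => by
    rw [sliceFactor_toStratumRing]
    exact isUnit_one

variable (F) in
/-- The restriction of functions from the chart to the stratum. -/
def chartToStratum : A.chartRing F →ₐ[k] A.stratumRing F :=
  IsLocalization.Away.liftAlgHom (A.sliceDenom F) A.isUnit_toStratumRing_sliceDenom

theorem chartToStratum_toChartRing (x : A.coordRing) :
    A.chartToStratum F (A.toChartRing F x) = A.toStratumRing F x :=
  awayLiftAlgHom_algebraMap _ A.isUnit_toStratumRing_sliceDenom x

theorem chartToStratum_comp_toChartRing :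
    (A.chartToStratum F).comp (A.toChartRing F) = A.toStratumRing F :=
  AlgHom.ext A.chartToStratum_toChartRing

variable (hF : A.matroid.IsFlat F)

theorem chartToStratum_chartFst (j : (Fᶜ : Set I)) :
    A.chartToStratum F (A.chartFst hF ((A.restriction F hF).coord j)) = 0 := by
  have hfactor : A.chartToStratum F (A.sliceFactor F (A.toChartRing F) j) = 1 := by
    rw [sliceFactor, map_sub, map_one, map_mul, chartToStratum_toChartRing,
      toStratumRing_coord_eq_zero, mul_zero, sub_zero]
  have hfst := congrArg (A.chartToStratum F) (A.chartFst_coord_mul hF j)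
  rwa [map_mul, hfactor, mul_one, chartToStratum_toChartRing, toStratumRing_coord_eq_zero] at hfst

theorem chartToStratum_comp_chartHom :
    (A.chartToStratum F).comp (A.chartHom hF) = A.evalZeroTensor hF := by
  refine Algebra.TensorProduct.ext (coordRing_algHom_ext fun j => ?_)
    (stratumRing_algHom_ext fun i => ?_)
  · change A.chartToStratum F (A.chartHom hF (_ ⊗ₜ 1)) = A.evalZeroTensor hF (_ ⊗ₜ 1)
    rw [chartHom_tmul, map_one, mul_one, chartToStratum_chartFst, evalZeroTensor_coord_tmul]
  · change A.chartToStratum F (A.chartHom hF (1 ⊗ₜ _)) = A.evalZeroTensor hF (1 ⊗ₜ _)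
    rw [chartHom_tmul, map_one, one_mul, chartSnd_coord, chartToStratum_toChartRing,
      evalZeroTensor_one_tmul]

end ChartSection

section Schemes

theorem recipPlaneToBase_eq :
    A.recipPlaneToBase = Spec.map (CommRingCat.ofHom (algebraMap k A.coordRing)) :=
  rfl

variable (F : Set I)

theorem stratumToBase_eq :
    A.stratumToBase F = Spec.map (CommRingCat.ofHom (algebraMap k (A.stratumRing F))) :=
  specMapAlgHom_comp_algebraMap (A.toStratumRing F)

/-- The open subscheme of the reciprocal plane that is mapped to `X_{A^F} × X_{A,F}`. -/
def chartDomain : A.recipPlane.Opens :=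
  PrimeSpectrum.basicOpen (A.sliceDenom F)

theorem chartDomain_le_openStar : A.chartDomain F ≤ A.openStar F := by
  intro y hy i hi
  exact hy (Ideal.mem_of_dvd _ (A.coord_dvd_sliceDenom F i) hi)

/-- The open subscheme `chartDomain F` is the spectrum of `chartRing F`. -/
def chartDomainIso : (A.chartDomain F : Scheme.{u}) ≅ Spec (.of (A.chartRing F)) :=
  basicOpenIsoSpecAway (R := .of A.coordRing) (A.sliceDenom F)

theorem chartDomainIso_hom_comp :
    (A.chartDomainIso F).hom ≫ specMapAlgHom (A.toChartRing F) = (A.chartDomain F).ι :=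
  basicOpenIsoSpecAway_hom_SpecMap (R := .of A.coordRing) (A.sliceDenom F)

/-- The inclusion of the stratum into the chart. -/
def chartSection : A.stratum F ⟶ (A.chartDomain F : Scheme.{u}) :=
  specMapAlgHom (A.chartToStratum F) ≫ (A.chartDomainIso F).inv

theorem chartSection_ι : A.chartSection F ≫ (A.chartDomain F).ι = A.stratumι F := by
  rw [chartSection, ← chartDomainIso_hom_comp, Category.assoc, Iso.inv_hom_id_assoc,
    specMapAlgHom_comp, chartToStratum_comp_toChartRing]
  rfl

variable {F} (hF : A.matroid.IsFlat F)

/-- The product `X_{A^F} × X_{A,F}` is affine, with coordinate ring the tensor product. -/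
def sliceProductIso : pullback (A.restriction F hF).recipPlaneToBase (A.stratumToBase F) ≅
    Spec (.of ((A.restriction F hF).coordRing ⊗[k] A.stratumRing F)) :=
  pullback.congrHom (A.restriction F hF).recipPlaneToBase_eq (A.stratumToBase_eq F) ≪≫
    pullbackSpecIso k (A.restriction F hF).coordRing (A.stratumRing F)

theorem sliceProductIso_inv_fst : (A.sliceProductIso hF).inv ≫ pullback.fst _ _ =
    specMapAlgHom (Algebra.TensorProduct.includeLeft (S := k)) := by
  rw [sliceProductIso, Iso.trans_inv, Category.assoc, pullback.congrHom_inv, pullback.lift_fst,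
    Category.comp_id]
  exact pullbackSpecIso_inv_fst k _ _

theorem sliceProductIso_inv_snd : (A.sliceProductIso hF).inv ≫ pullback.snd _ _ =
    specMapAlgHom Algebra.TensorProduct.includeRight := by
  rw [sliceProductIso, Iso.trans_inv, Category.assoc, pullback.congrHom_inv, pullback.lift_snd,
    Category.comp_id]
  exact pullbackSpecIso_inv_snd k _ _

theorem zeroSection_eq : A.zeroSection F hF =
    specMapAlgHom (A.evalZeroTensor hF) ≫ (A.sliceProductIso hF).inv := by
  apply pullback.hom_ext
  · rw [Category.assoc, sliceProductIso_inv_fst, zeroSection, pullback.lift_fst, stratumToBase_eq,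
      specMapAlgHom_comp, evalZeroTensor_comp_includeLeft]
    exact specMapAlgHom_comp (A.restriction F hF).evalZeroₐ (Algebra.ofId k (A.stratumRing F))
  · rw [Category.assoc, sliceProductIso_inv_snd, zeroSection, pullback.lift_snd,
      specMapAlgHom_comp, evalZeroTensor_comp_includeRight, specMapAlgHom_id]

/-- The morphism `Φ` from the chart to `X_{A^F} × X_{A,F}`. -/
def chartMorphism : (A.chartDomain F : Scheme.{u}) ⟶ A.sliceProduct F hF :=
  (A.chartDomainIso F).hom ≫ specMapAlgHom (A.chartHom hF) ≫ (A.sliceProductIso hF).inv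

theorem chartMorphism_toBase : A.chartMorphism hF ≫ A.sliceProductToBase F hF =
    (A.chartDomain F).ι ≫ A.recipPlaneToBase := by
  rw [chartMorphism, sliceProductToBase, ← chartDomainIso_hom_comp, Category.assoc, Category.assoc,
    Category.assoc, ← Category.assoc (A.sliceProductIso hF).inv, sliceProductIso_inv_snd,
    stratumToBase_eq, recipPlaneToBase_eq,
    specMapAlgHom_comp_algebraMap, specMapAlgHom_comp_algebraMap, specMapAlgHom_comp_algebraMap]

theorem chartSection_chartMorphism :
    A.chartSection F ≫ A.chartMorphism hF = A.zeroSection F hF := by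
  rw [chartSection, chartMorphism, Category.assoc, Iso.inv_hom_id_assoc, zeroSection_eq,
    ← Category.assoc, specMapAlgHom_comp, chartToStratum_comp_chartHom]

instance : IsOpenImmersion (A.chartMorphism hF) :=
  have := A.isOpenImmersion_specMapAlgHom_chartHom hF
  inferInstanceAs (IsOpenImmersion (_ ≫ _ ≫ _))

end Schemes

end

end Arrangement

theorem theorem3p3_general {k : Type u} {I : Type u} {V : Type v} [Field k] [Finite I]
    [AddCommGroup V] [Module k V] [FiniteDimensional k V] (A : Arrangement k I V)
    (F : Set I) (hF : A.matroid.IsFlat F) :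
    ∃ (W : A.recipPlane.Opens) (_ : W ≤ A.openStar F) (σ : A.stratum F ⟶ (W : Scheme.{u}))
      (Φ : (W : Scheme.{u}) ⟶ A.sliceProduct F hF),
      σ ≫ W.ι = A.stratumι F ∧
      Φ ≫ A.sliceProductToBase F hF = W.ι ≫ A.recipPlaneToBase ∧
      σ ≫ Φ = A.zeroSection F hF ∧
      IsOpenImmersion Φ :=
  ⟨A.chartDomain F, A.chartDomain_le_openStar F, A.chartSection F, A.chartMorphism hF,
    A.chartSection_ι F, A.chartMorphism_toBase hF, A.chartSection_chartMorphism hF, inferInstance⟩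

theorem theorem3p3 {k : Type u} {I : Type u} {V : Type v} [Field k] [Finite I]
    [AddCommGroup V] [Module k V] [FiniteDimensional k V] (A : Arrangement k I V)
    (F : Set I) (hF : A.matroid.IsFlat F) (x : A.stratum F) :
    ∃ (W : A.recipPlane.Opens) (_ : W ≤ A.openStar F) (hx : A.stratumι F x ∈ W)
      (Φ : (W : Scheme.{u}) ⟶ A.sliceProduct F hF),
      -- `Φ` is a morphism over `k`
      Φ ≫ A.sliceProductToBase F hF = W.ι ≫ A.recipPlaneToBase ∧
      -- `Φ(x) = (0, x)`, as points with values in the residue field of `x`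
      (∃ xW : Spec ((A.stratum F).residueField x) ⟶ (W : Scheme.{u}),
        xW ≫ W.ι = (A.stratum F).fromSpecResidueField x ≫ A.stratumι F ∧
        xW ≫ Φ = (A.stratum F).fromSpecResidueField x ≫ A.zeroSection F hF) ∧
      EtaleAt Φ ⟨A.stratumι F x, hx⟩ := by
  obtain ⟨W, hW, σ, Φ, hσ, hbase, hzero, hΦ⟩ := theorem3p3_general A F hF
  exact ⟨W, hW, hσ ▸ (σ x).2, Φ, hbase, ⟨(A.stratum F).fromSpecResidueField x ≫ σ,
    by rw [Category.assoc, hσ], by rw [Category.assoc, hzero]⟩, ⊤, trivial, inferInstance⟩
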